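/- Let $\mathbb P(\mathbb Z)$ be the set of cyclic submodules $\mathbb Z(a,b)\subset\mathbb Z^2$ with $(a,b)$ unimodular, and let $G$ be the distant graph on it: $\bar x,\bar y$ are adjacent iff the matrix $[x,y]$ lies in $GL_2(\mathbb Z)$ for all unimodular representatives $x\in\bar x$, $y\in\bar y$. Let $\bar x\ne\bar y$ be non-adjacent. Choose unimodular representatives $x,y$ with $\det[x,y]>0$, and take $x$ and $y$ as directions of the coordinate axes of the plane (first quadrant: $\alpha x+\beta y$ with $\alpha,\beta>0$; second quadrant: $\alpha<0<\beta$). *Transition algorithm:* start with the unique $e,f=e-x$ such that $\det[x,e]=1$, $e$ is in the first quadrant and $f$ in the second one. If $e+f=y$, stop. Otherwise replace $(e,f)$ by $(e+f,f)$ if $e+f$ is in the first quadrant and by $(e,e+f)$ if it is in the second one, and repeat. The algorithm stops, and the sequence of steps does not depend on the representatives. Write it as maximal runs of steps of the same kind, of lengths $c_1,c_2,\dots,c_{r+l}$ with $r-l\in\{0,1\}$, and put $a_k=c_{2k-1}$ $(1\le k\le r)$, $b_k=c_{2k}$ $(1\le k\le l)$, $a_0=b_0=1$. Put $\tilde a_1=\max(a_1,2)$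 and $\tilde a_k=a_k$ for $k\neq1$; if $r=l$ put $\tilde b_l=\max(b_l,2)$; in all other cases put $\tilde b_k=b_k$. For $1\le k\le l$ let $s_k$ be the largest $j\in\{0,\dots,k\}$ with $\tilde b_{k-1}=\dots=\tilde b_{k-j}=1$, and let $t_k$ be the largest $j\in\{0,\dots,k\}$ with $\tilde a_{k-1}=\dots=\tilde a_{k-j}=1$. Let $D$ be the set of all $k\in\{1,\dots,l\}$ except those with $\tilde b_k>1$, $\tilde a_k=1$ and $s_k>t_k$. Then $\bar x$ and $\bar y$ are joined by a path in $G$ and $$\mathrm{dist}(\bar x,\bar y)=\begin{cases} r+l+1-\displaystyle\sum_{k\in D}\left\lfloor\tfrac12\left(\left\lfloor\tfrac1{\tilde a_k}\right\rfloor+\left\lfloor\tfrac1{\tilde b_k}\right\rfloor\right)+\tfrac12\right\rfloor & \text{if } l>0,\\ 2 & \text{if } l=0.\end{cases}$$ In particular, $G$ has infinite diameter. -/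

import Mathlib

/-- The projective line over `ℤ`: the cyclic submodules of `ℤ × ℤ` generated by a unimodular
pair `(a, b)` (that is, `a * u + b * v = 1` for some integers `u`, `v`). -/
def ProjLine : Type :=
  {p : Submodule ℤ (ℤ × ℤ) // ∃ a b : ℤ, IsCoprime a b ∧ p = Submodule.span ℤ {(a, b)}}

/-- `u` is an admissible representative of the point `p`: a unimodular pair lying in `p`. -/
def IsRep (u : ℤ × ℤ) (p : ProjLine) : Prop :=
  IsCoprime u.1 u.2 ∧ u ∈ p.1

/-- The distant relation: the matrix with columns `u`, `v` lies in `GL₂(ℤ)` for any choice of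
admissible representatives `u`, `v` of the two points. -/
def Distant (p q : ProjLine) : Prop :=
  ∀ u v : ℤ × ℤ, IsRep u p → IsRep v q →
    IsUnit (!![u.1, v.1; u.2, v.2] : Matrix (Fin 2) (Fin 2) ℤ)

theorem Distant.symm {p q : ProjLine} (h : Distant p q) : Distant q p := by
  intro u v hu hv
  have h1 := h v u hv hu
  rw [Matrix.isUnit_iff_isUnit_det, Matrix.det_fin_two_of] at h1 ⊢
  have h2 : u.1 * v.2 - v.1 * u.2 = -(v.1 * u.2 - u.1 * v.2) := by ring
  rw [h2]
  exact h1.neg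

theorem Distant.irrefl (p : ProjLine) : ¬ Distant p p := by
  intro h
  obtain ⟨a, b, hab, hp⟩ := p.2
  have hr : IsRep (a, b) p := ⟨hab, by rw [hp]; exact Submodule.mem_span_singleton_self _⟩
  have h1 := h _ _ hr hr
  rw [Matrix.isUnit_iff_isUnit_det, Matrix.det_fin_two_of] at h1
  simp at h1

/-- The distant graph of the projective line over `ℤ`. -/
def distantGraph : SimpleGraph ProjLine where
  Adj := Distant
  symm := ⟨fun _ _ h => h.symm⟩
  loopless := ⟨fun p h => Distant.irrefl p h⟩

/-- `v` lies in the (open) first quadrant of the axes directed by `x` and `y`. -/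
def InFirstQuadrant (x y v : ℤ × ℤ) : Prop :=
  ∃ α β : ℝ, 0 < α ∧ 0 < β ∧
    (v.1 : ℝ) = α * x.1 + β * y.1 ∧ (v.2 : ℝ) = α * x.2 + β * y.2

/-- `v` lies in the (open) second quadrant of the axes directed by `x` and `y`. -/
def InSecondQuadrant (x y v : ℤ × ℤ) : Prop :=
  ∃ α β : ℝ, α < 0 ∧ 0 < β ∧
    (v.1 : ℝ) = α * x.1 + β * y.1 ∧ (v.2 : ℝ) = α * x.2 + β * y.2

/-- `TransitionRun x y e f w`: the transition algorithm towards `y`, started at the basis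
`(e, f)`, stops, and `w` is the word of the steps made.  A letter `true` is a step
`(e, f) ↦ (e + f, f)` (the sum lies in the first quadrant), a letter `false` is a step
`(e, f) ↦ (e, e + f)` (the sum lies in the second quadrant); the algorithm stops as soon as
`e + f = y`. -/
inductive TransitionRun (x y : ℤ × ℤ) : ℤ × ℤ → ℤ × ℤ → List Bool → Prop
  | done {e f : ℤ × ℤ} (h : e + f = y) : TransitionRun x y e f []
  | first {e f : ℤ × ℤ} {w : List Bool} (hne : e + f ≠ y)
      (hq : InFirstQuadrant x y (e + f)) (hw : TransitionRun x y (e + f) f w) :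
      TransitionRun x y e f (true :: w)
  | second {e f : ℤ × ℤ} {w : List Bool} (hne : e + f ≠ y)
      (hq : InSecondQuadrant x y (e + f)) (hw : TransitionRun x y e (e + f) w) :
      TransitionRun x y e f (false :: w)

/-- `w` is the word of steps of the transition algorithm for the points `p`, `q`: for
admissible representatives `x`, `y`, the algorithm starts at the basis `(e, f)`, where
`det [x, e] = 1`, `f = e - x`, `e` is in the first quadrant and `f` in the second one. -/
def IsTransitionWord (p q : ProjLine) (w : List Bool) : Prop :=
  ∃ x y e f : ℤ × ℤ, IsRep x p ∧ IsRep y q ∧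
    x.1 * e.2 - x.2 * e.1 = 1 ∧ f = e - x ∧
    InFirstQuadrant x y e ∧ InSecondQuadrant x y f ∧ TransitionRun x y e f w

/-- The lengths `(c₁, c₂, …) = (a₁, b₁, a₂, b₂, …)` of the maximal runs of equal steps. -/
def runLengths (w : List Bool) : List ℕ :=
  (w.splitBy (· == ·)).map List.length

/-- The number `r` of runs on the side on which the algorithm makes its first step. -/
def numR (w : List Bool) : ℕ := ((runLengths w).length + 1) / 2

/-- The number `l` of runs on the other side. -/
def numL (w : List Bool) : ℕ := (runLengths w).length / 2

/-- `a₁, …, a_r`: the runs on the side of the first step, that is `a_k = c_{2k-1}`, with the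
convention `a₀ = a_{r+1} = 1`. -/
def seqA (w : List Bool) : ℕ → ℕ
  | 0 => 1
  | k + 1 => (runLengths w).getD (2 * k) 1

/-- `b₁, …, b_l`: the runs on the other side, that is `b_k = c_{2k}`, with the convention
`b₀ = b_{l+1} = 1`. -/
def seqB (w : List Bool) : ℕ → ℕ
  | 0 => 1
  | k + 1 => (runLengths w).getD (2 * k + 1) 1

/-- `ã_k`: equal to `a_k`, except that `ã₁ = max (a₁, 2)`. -/
def tildeA (w : List Bool) (k : ℕ) : ℕ :=
  if k = 1 then max (seqA w k) 2 else seqA w k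

/-- `b̃_k`: equal to `b_k`, except that `b̃_l = max (b_l, 2)` if `r = l`. -/
def tildeB (w : List Bool) (k : ℕ) : ℕ :=
  if numR w = numL w ∧ k = numL w then max (seqB w k) 2 else seqB w k

/-- The length of the block of ones of the sequence `u` that ends just before the index `k`:
the largest `j ≤ k` with `u (k-1) = ⋯ = u (k-j) = 1`. -/
def onesBefore (u : ℕ → ℕ) (k : ℕ) : ℕ :=
  Nat.findGreatest (fun j => ∀ i < j, u (k - 1 - i) = 1) k

/-- The index set `D`: all `k ∈ {1, …, l}` except those with `b̃_k > 1`, `ã_k = 1` and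
`s_k > t_k`, where `s_k`, `t_k` are the lengths of the blocks of ones of `b̃`, `ã` that end just
before the index `k`. -/
def indexD (w : List Bool) : Finset ℕ :=
  (Finset.Icc 1 (numL w)).filter fun k =>
    ¬ (tildeB w k > 1 ∧ tildeA w k = 1 ∧
        onesBefore (tildeB w) k > onesBefore (tildeA w) k)

/-- The summand at `k` (the outer bracket is an integer part). -/
def shortening (w : List Bool) (k : ℕ) : ℤ :=
  ⌊(1 / 2 : ℚ) * ((⌊1 / (tildeA w k : ℚ)⌋ : ℚ) + (⌊1 / (tildeB w k : ℚ)⌋ : ℚ)) + 1 / 2⌋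

/-!
Two points of the projective line over `ℤ` are distant iff representatives `u`, `v` satisfy
`cross u v = ±1`, so the distant graph is the Farey graph. In the integral basis `(e, f)` given
by an edge, the two coordinates of a point have opposite signs, or equal signs, or one of them is
zero; in the last case the point is one of the two ends of the edge. A determinant `a * d - b * c`
with `a * b > 0` and `c * d < 0` cannot be `±1`, so a walk between the two sides passes through an
end of the edge (`edge_separates`). Hence the mediant `e + f` of an edge that separates it from `x`
has distance `1 + min` of the distances of `e` and `f` to `x` (`edist_mediant`). Every basis which
the transition algorithm reaches is such an edge, and the distance from `x` to `y` is computed by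
an automaton reading the word of steps (`edist_eq_wordDist`). The algorithm is the subtractive
Euclidean algorithm on the coordinates of `y`, so it stops; the quadrant conditions are sign
conditions on `cross`, which gives determinism and the uniqueness of the start.

The state of the automaton is the pair of distances of `e` and `f`. After each run of equal steps
the pair is either balanced or off by one towards the side of that run, and the minimum increases
at the beginning of a run exactly if the pair was not balanced. Balance obeys the recursion
`q 0 = true`, `q (i + 1) ↔ c i = 1 ∧ ¬ q i` in the lengths `c i` of the runs, so the distance is
`2` plus the number of `i` below the number of runs with `¬ q i` (`wordDist_one_one`). The
comparison of the blocks of ones in the formula satisfies the same recursion over pairs of runs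
(`balanced_two_mul_iff`), and a pair of runs contributes `1` to the sum of the formula exactly if
one of its two runs ends balanced, the very last run of the word left aside (`sum_balanced`,
`sum_balanced_even`).
-/

/-! ### Representatives and the distant relation -/

/-- The determinant of the matrix with columns `u` and `v`. -/
def cross (u v : ℤ × ℤ) : ℤ := u.1 * v.2 - u.2 * v.1

theorem IsRep.neg {u : ℤ × ℤ} {p : ProjLine} (h : IsRep u p) : IsRep (-u) p :=
  ⟨h.1.neg_neg, p.1.neg_mem h.2⟩

theorem exists_isRep (p : ProjLine) : ∃ u, IsRep u p := by
  obtain ⟨a, b, hab, hp⟩ := p.2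
  exact ⟨(a, b), hab, by rw [hp]; exact Submodule.mem_span_singleton_self _⟩

theorem exists_point {u : ℤ × ℤ} (h : IsCoprime u.1 u.2) : ∃ p, IsRep u p :=
  ⟨⟨Submodule.span ℤ {(u.1, u.2)}, u.1, u.2, h, rfl⟩, h, Submodule.mem_span_singleton_self _⟩

theorem isUnit_of_isCoprime_mul {k a b : ℤ} (h : IsCoprime (k * a) (k * b)) : IsUnit k := by
  obtain ⟨s, t, hst⟩ := h
  exact IsUnit.of_mul_eq_one (s * a + t * b) (by linarith)

theorem IsRep.span_eq {u : ℤ × ℤ} {p : ProjLine} (h : IsRep u p) :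
    p.1 = Submodule.span ℤ {u} := by
  obtain ⟨a, b, hab, hp⟩ := p.2
  obtain ⟨h1, h2⟩ := h
  rw [hp] at h2 ⊢
  obtain ⟨k, rfl⟩ := Submodule.mem_span_singleton.1 h2
  exact (Submodule.span_singleton_smul_eq (isUnit_of_isCoprime_mul h1) _).symm

theorem IsRep.point_eq {u : ℤ × ℤ} {p q : ProjLine} (hp : IsRep u p) (hq : IsRep u q) : p = q :=
  Subtype.ext (hp.span_eq.trans hq.span_eq.symm)

theorem IsRep.eq_or_eq_neg {u v : ℤ × ℤ} {p : ProjLine} (hu : IsRep u p) (hv : IsRep v p) :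
    v = u ∨ v = -u := by
  have h := hv.2
  rw [hu.span_eq] at h
  obtain ⟨k, rfl⟩ := Submodule.mem_span_singleton.1 h
  rcases Int.isUnit_iff.1 (isUnit_of_isCoprime_mul hv.1) with rfl | rfl <;> simp

theorem adj_iff {p q : ProjLine} {u v : ℤ × ℤ} (hu : IsRep u p) (hv : IsRep v q) :
    distantGraph.Adj p q ↔ cross u v = 1 ∨ cross u v = -1 := by
  have key (u v : ℤ × ℤ) : IsUnit (!![u.1, v.1; u.2, v.2] : Matrix (Fin 2) (Fin 2) ℤ) ↔
      cross u v = 1 ∨ cross u v = -1 := by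
    rw [Matrix.isUnit_iff_isUnit_det, Matrix.det_fin_two_of, Int.isUnit_iff, cross,
      mul_comm v.1 u.2]
  constructor
  · intro h
    exact (key u v).1 (h u v hu hv)
  · intro h u' v' hu' hv'
    rw [key]
    rcases hu.eq_or_eq_neg hu' with rfl | rfl <;> rcases hv.eq_or_eq_neg hv' with rfl | rfl <;>
      simp only [cross, Prod.fst_neg, Prod.snd_neg] at h ⊢ <;> grind

theorem isCoprime_of_cross {u v : ℤ × ℤ} (h : cross u v = 1) : IsCoprime u.1 u.2 :=
  ⟨v.2, -v.1, by unfold cross at h; linarith⟩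

/-- Cramer's rule for the integral basis `(e, f)`. -/
theorem eq_cross_combination {e f : ℤ × ℤ} (h : cross e f = 1) (v : ℤ × ℤ) :
    v = cross v f • e + cross e v • f := by
  unfold cross at *
  ext
  · simp; linear_combination -v.1 * h
  · simp; linear_combination -v.2 * h

theorem cross_combination {e f : ℤ × ℤ} (h : cross e f = 1) (a b c d : ℤ) :
    cross (a • e + b • f) (c • e + d • f) = a * d - b * c := by
  unfold cross at *
  simp
  linear_combination (a * d - b * c) * h

theorem cross_add_left {e f : ℤ × ℤ} (h : cross e f = 1) : cross (e + f) f = 1 := by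
  simp only [cross, Prod.fst_add, Prod.snd_add] at *; linarith

theorem cross_add_right {e f : ℤ × ℤ} (h : cross e f = 1) : cross e (e + f) = 1 := by
  simp only [cross, Prod.fst_add, Prod.snd_add] at *; linarith

theorem cross_add_pos {x e f : ℤ × ℤ} (he : 0 < cross x e) (hf : 0 < cross x f) :
    0 < cross x (e + f) := by
  simp only [cross, Prod.fst_add, Prod.snd_add] at *; linarith

/-! ### Edges separate the graph -/

/-- An edge `{e, f}` of the Farey graph separates the points whose coordinates have opposite signs
from those whose coordinates have the same sign: a walk from one side to the other meets
`e` or `f`. -/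
theorem edge_separates {e f x : ℤ × ℤ} {pe pf p : ProjLine} (hef : cross e f = 1)
    (he : IsRep e pe) (hf : IsRep f pf) (hx : IsRep x p)
    (hxs : cross x f * cross e x < 0) {q : ProjLine} (W : distantGraph.Walk q p)
    {y : ℤ × ℤ} (hy : IsRep y q) (hys : 0 < cross y f * cross e y) :
    min (distantGraph.edist pe p) (distantGraph.edist pf p) + 1 ≤ W.length := by
  induction W generalizing y with
  | nil =>
    rcases hx.eq_or_eq_neg hy with rfl | rfl
    · linarith
    · simp only [cross, Prod.fst_neg, Prod.snd_neg] at *; linarith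
  | @cons q q' p hadj W ih =>
    obtain ⟨z, hz⟩ := exists_isRep q'
    rw [SimpleGraph.Walk.length_cons, Nat.cast_add, Nat.cast_one]
    have hW : distantGraph.edist q' p ≤ W.length := SimpleGraph.edist_le W
    rcases lt_trichotomy (cross z f * cross e z) 0 with h | h | h
    · -- The products `a * d` and `b * c` would be nonzero of opposite signs.
      exfalso
      have h1 := (adj_iff hy hz).1 hadj
      rw [eq_cross_combination hef y, eq_cross_combination hef z, cross_combination hef] at h1
      generalize cross y f = a at *
      generalize cross e y = b at *
      generalize cross z f = c at *
      generalize cross e z = d at *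
      have h2 : (a * d) * (b * c) < 0 := by
        have := mul_neg_of_pos_of_neg hys h
        linarith [show (a * d) * (b * c) = a * b * (c * d) by ring]
      generalize a * d = s at *
      generalize b * c = t at *
      rcases mul_neg_iff.1 h2 with h3 | h3 <;> omega
    · gcongr
      refine le_trans ?_ hW
      have hz' := eq_cross_combination hef z
      rcases mul_eq_zero.1 h with h0 | h0
      · rw [h0, zero_smul, zero_add] at hz'
        have : IsRep z pf := ⟨hz.1, hz' ▸ pf.1.smul_mem _ hf.2⟩
        rw [hz.point_eq this]
        exact min_le_right _ _
      · rw [h0, zero_smul, add_zero] at hz'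
        have : IsRep z pe := ⟨hz.1, hz' ▸ pe.1.smul_mem _ he.2⟩
        rw [hz.point_eq this]
        exact min_le_left _ _
    · exact (ih hx hz h).trans le_self_add

/-- The distance to the mediant `e + f` of an edge `{e, f}` that separates it from `x`. -/
theorem edist_mediant {e f x : ℤ × ℤ} {pe pf p q : ProjLine} (hef : cross e f = 1)
    (he : IsRep e pe) (hf : IsRep f pf) (hx : IsRep x p)
    (hxs : cross x f * cross e x < 0) (hq : IsRep (e + f) q) :
    distantGraph.edist q p =
      min (distantGraph.edist pe p) (distantGraph.edist pf p) + 1 := by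
  apply le_antisymm
  · rw [← min_add_add_right, le_min_iff]
    constructor
    · rw [add_comm]
      refine SimpleGraph.edist_triangle.trans (add_le_add_left ?_ _)
      refine le_of_eq (SimpleGraph.edist_eq_one_iff_adj.2 ((adj_iff hq he).2 (Or.inr ?_)))
      simp only [cross, Prod.fst_add, Prod.snd_add] at *; linarith
    · rw [add_comm]
      refine SimpleGraph.edist_triangle.trans (add_le_add_left ?_ _)
      refine le_of_eq (SimpleGraph.edist_eq_one_iff_adj.2 ((adj_iff hq hf).2 (Or.inl ?_)))
      simp only [cross, Prod.fst_add, Prod.snd_add] at *; linarith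
  · refine le_iInf fun W => edge_separates hef he hf hx hxs W hq ?_
    rw [cross_add_left hef, cross_add_right hef]; norm_num

theorem edist_mediant_natCast {e f x : ℤ × ℤ} {pe pf p q : ProjLine} {d d' : ℕ}
    (hef : cross e f = 1) (he : IsRep e pe) (hf : IsRep f pf) (hx : IsRep x p)
    (hxe : 0 < cross x e) (hxf : 0 < cross x f) (hq : IsRep (e + f) q)
    (hd : distantGraph.edist pe p = d) (hd' : distantGraph.edist pf p = d') :
    distantGraph.edist q p = (min d d' + 1 : ℕ) := by
  have hex : cross e x < 0 := by unfold cross at *; linarith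
  rw [edist_mediant hef he hf hx (mul_neg_of_pos_of_neg hxf hex) hq, hd, hd']
  rcases le_total d d' with h | h <;> simp [h]

/-! ### The transition algorithm -/

theorem inFirstQuadrant_iff {x y v : ℤ × ℤ} (h : 0 < cross x y) :
    InFirstQuadrant x y v ↔ 0 < cross x v ∧ 0 < cross v y := by
  have hR : (0 : ℝ) < x.1 * y.2 - x.2 * y.1 := by unfold cross at h; exact_mod_cast h
  constructor
  · rintro ⟨α, β, hα, hβ, h1, h2⟩
    have e1 : (cross x v : ℝ) = β * (x.1 * y.2 - x.2 * y.1) := by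
      unfold cross; push_cast; rw [h1, h2]; ring
    have e2 : (cross v y : ℝ) = α * (x.1 * y.2 - x.2 * y.1) := by
      unfold cross; push_cast; rw [h1, h2]; ring
    exact ⟨by exact_mod_cast e1 ▸ mul_pos hβ hR, by exact_mod_cast e2 ▸ mul_pos hα hR⟩
  · rintro ⟨h1, h2⟩
    refine ⟨cross v y / (x.1 * y.2 - x.2 * y.1), cross x v / (x.1 * y.2 - x.2 * y.1),
      div_pos (by exact_mod_cast h2) hR, div_pos (by exact_mod_cast h1) hR, ?_, ?_⟩ <;>
    · rw [div_mul_eq_mul_div, div_mul_eq_mul_div, ← add_div, eq_div_iff hR.ne']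
      unfold cross; push_cast; ring

theorem inSecondQuadrant_iff {x y v : ℤ × ℤ} (h : 0 < cross x y) :
    InSecondQuadrant x y v ↔ 0 < cross x v ∧ cross v y < 0 := by
  have hR : (0 : ℝ) < x.1 * y.2 - x.2 * y.1 := by unfold cross at h; exact_mod_cast h
  constructor
  · rintro ⟨α, β, hα, hβ, h1, h2⟩
    have e1 : (cross x v : ℝ) = β * (x.1 * y.2 - x.2 * y.1) := by
      unfold cross; push_cast; rw [h1, h2]; ring
    have e2 : (cross v y : ℝ) = α * (x.1 * y.2 - x.2 * y.1) := by
      unfold cross; push_cast; rw [h1, h2]; ring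
    exact ⟨by exact_mod_cast e1 ▸ mul_pos hβ hR,
      by exact_mod_cast e2 ▸ mul_neg_of_neg_of_pos hα hR⟩
  · rintro ⟨h1, h2⟩
    refine ⟨cross v y / (x.1 * y.2 - x.2 * y.1), cross x v / (x.1 * y.2 - x.2 * y.1),
      div_neg_of_neg_of_pos (by exact_mod_cast h2) hR, div_pos (by exact_mod_cast h1) hR, ?_, ?_⟩ <;>
    · rw [div_mul_eq_mul_div, div_mul_eq_mul_div, ← add_div, eq_div_iff hR.ne']
      unfold cross; push_cast; ring

theorem InFirstQuadrant.neg {x y v : ℤ × ℤ} (h : InFirstQuadrant x y v) :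
    InFirstQuadrant (-x) (-y) (-v) := by
  obtain ⟨α, β, hα, hβ, h1, h2⟩ := h
  exact ⟨α, β, hα, hβ, by simp [h1]; ring, by simp [h2]; ring⟩

theorem InSecondQuadrant.neg {x y v : ℤ × ℤ} (h : InSecondQuadrant x y v) :
    InSecondQuadrant (-x) (-y) (-v) := by
  obtain ⟨α, β, hα, hβ, h1, h2⟩ := h
  exact ⟨α, β, hα, hβ, by simp [h1]; ring, by simp [h2]; ring⟩

theorem TransitionRun.neg {x y e f : ℤ × ℤ} {w : List Bool} (h : TransitionRun x y e f w) :
    TransitionRun (-x) (-y) (-e) (-f) w := by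
  induction h with
  | done h => exact .done (by rw [← h, neg_add])
  | first hne hq _ ih =>
    rw [neg_add] at ih
    refine .first ?_ ?_ ?_
    · rwa [← neg_add, Ne, neg_inj]
    · rw [← neg_add]; exact hq.neg
    · exact ih
  | second hne hq _ ih =>
    rw [neg_add] at ih
    refine .second ?_ ?_ ?_
    · rwa [← neg_add, Ne, neg_inj]
    · rw [← neg_add]; exact hq.neg
    · exact ih

theorem TransitionRun.unique {x y e f : ℤ × ℤ} (hxy : 0 < cross x y) {w w' : List Bool}
    (h : TransitionRun x y e f w) (h' : TransitionRun x y e f w') : w = w' := by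
  induction h generalizing w' with
  | done h =>
    cases h' with
    | done => rfl
    | first hne => exact absurd h hne
    | second hne => exact absurd h hne
  | first hne hq _ ih =>
    cases h' with
    | done h => exact absurd h hne
    | first _ _ hw => rw [ih hw]
    | second _ hq' =>
      rw [inFirstQuadrant_iff hxy] at hq
      rw [inSecondQuadrant_iff hxy] at hq'
      omega
  | second hne hq _ ih =>
    cases h' with
    | done h => exact absurd h hne
    | second _ _ hw => rw [ih hw]
    | first _ hq' =>
      rw [inSecondQuadrant_iff hxy] at hq
      rw [inFirstQuadrant_iff hxy] at hq'
      omega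

/-- The algorithm stops: it runs the subtractive Euclidean algorithm on the coordinates `(m, n)` of
`y` in the basis `(e, f)`. -/
theorem exists_transitionRun {x y : ℤ × ℤ} (hxy : 0 < cross x y) (hy : IsCoprime y.1 y.2)
    (N : ℕ) {e f : ℤ × ℤ} {m n : ℤ} (hN : m + n ≤ N) (hm : 0 < m) (hn : 0 < n)
    (hef : cross e f = 1) (he : 0 < cross x e) (hf : 0 < cross x f)
    (hmn : y = m • e + n • f) : ∃ w, TransitionRun x y e f w := by
  induction N generalizing e f m n with
  | zero => push_cast at hN; omega
  | succ N ih =>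
    have hg := cross_add_pos he hf
    have hgf := cross_add_left hef
    have heg := cross_add_right hef
    have hgy : cross (e + f) y = n - m := by
      have := cross_combination hef 1 1 m n
      rw [one_smul, one_smul, ← hmn] at this
      linarith
    have hne (h : e + f = y) : n = m := by
      rw [h] at hgy
      unfold cross at hgy
      linarith
    push_cast at hN
    -- By `hgy` the sum lies in the first quadrant iff `m < n`; if `m = n`, unimodularity of `y`
    -- forces `m = n = 1`.
    rcases lt_trichotomy m n with h | h | h
    · obtain ⟨w, hw⟩ := ih (e := e + f) (f := f) (m := m) (n := n - m) (by omega) hm (by omega) hgf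
        hg hf (by rw [hmn]; module)
      exact ⟨true :: w, .first (fun h' => h.ne' (hne h'))
        ((inFirstQuadrant_iff hxy).2 ⟨hg, by omega⟩) hw⟩
    · subst h
      have h1 : y = m • (e + f) := by rw [hmn]; module
      have h2 : IsUnit m := by
        apply isUnit_of_isCoprime_mul (a := (e + f).1) (b := (e + f).2)
        rw [h1] at hy
        exact hy
      have h3 : m = 1 := by
        rcases Int.isUnit_iff.1 h2 with h | h <;> omega
      exact ⟨[], .done (by rw [h1, h3, one_smul])⟩
    · obtain ⟨w, hw⟩ := ih (e := e) (f := e + f) (m := m - n) (n := n) (by omega) (by omega) hn heg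
        he hg (by rw [hmn]; module)
      exact ⟨false :: w, .second (fun h' => h.ne (hne h'))
        ((inSecondQuadrant_iff hxy).2 ⟨hg, by omega⟩) hw⟩

theorem exists_transitionWord {p q : ProjLine} (hpq : p ≠ q) (hadj : ¬ distantGraph.Adj p q) :
    ∃ w, IsTransitionWord p q w := by
  obtain ⟨x, hx⟩ := exists_isRep p
  obtain ⟨y, hy, hpos⟩ : ∃ y, IsRep y q ∧ 0 ≤ cross x y := by
    obtain ⟨y, hy⟩ := exists_isRep q
    rcases le_total 0 (cross x y) with h | h
    · exact ⟨y, hy, h⟩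
    · refine ⟨-y, hy.neg, ?_⟩
      simp only [cross, Prod.fst_neg, Prod.snd_neg] at *; linarith
  have hxy := mt (adj_iff hx hy).2 hadj
  obtain ⟨s, t, hst⟩ := hx.1
  -- `e₀` completes `x` to a basis; the other completions are `e₀ + k • x`.
  let e₀ : ℤ × ℤ := (-t, s)
  have he₀ : cross x e₀ = 1 := by simp only [cross, e₀]; linarith
  have hy₀ := eq_cross_combination he₀ y
  have h0 : cross x y ≠ 0 := by
    intro h0
    rw [h0, zero_smul, add_zero] at hy₀
    refine hpq (IsRep.point_eq (u := y) ⟨hy.1, ?_⟩ hy)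
    rw [hy₀]
    exact p.1.smul_mem _ hx.2
  have hD : 1 < cross x y := by omega
  -- Reducing `cross e₀ y` modulo `cross x y` puts `e` and `e - x` on the two sides of `y`.
  let n := cross e₀ y % cross x y
  have hn0 : 0 ≤ n := Int.emod_nonneg _ h0
  have hnD : n < cross x y := Int.emod_lt_of_pos _ (by omega)
  let e := e₀ - (cross e₀ y / cross x y) • x
  have he : cross x e = 1 := by
    simp only [cross, e, Prod.fst_sub, Prod.snd_sub, Prod.smul_fst, Prod.smul_snd, smul_eq_mul]
      at he₀ ⊢
    linarith
  have hey : cross e y = n := by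
    have h1 : n = cross e₀ y - cross x y * (cross e₀ y / cross x y) := Int.emod_def _ _
    have h2 (k : ℤ) : cross (e₀ - k • x) y = cross e₀ y - cross x y * k := by
      unfold cross; simp; ring
    rw [h1, ← h2]
  have hye : y = (-n) • x + cross x y • e := by
    have := eq_cross_combination he y
    have h1 : cross y e = - n := by
      rw [← hey]; unfold cross; ring
    rwa [h1] at this
  have hn : n ≠ 0 := by
    intro h
    rw [h, neg_zero, zero_smul, zero_add] at hye
    have h1 : IsUnit (cross x y) := by
      apply isUnit_of_isCoprime_mul (a := e.1) (b := e.2)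
      have := hy.1
      rw [hye] at this
      exact this
    rcases Int.isUnit_iff.1 h1 with h | h <;> omega
  have hf : cross x (e - x) = 1 := by
    simp only [cross, Prod.fst_sub, Prod.snd_sub] at *; linarith
  have hfy : cross (e - x) y = n - cross x y := by
    rw [← hey]; unfold cross; simp; ring
  have hef : cross e (e - x) = 1 := by
    simp only [cross, Prod.fst_sub, Prod.snd_sub] at *; linarith
  obtain ⟨w, hw⟩ := exists_transitionRun (by omega) hy.1 (cross x y).toNat
    (m := cross x y - n) (n := n) (by omega) (by omega) (by omega) hef (he ▸ one_pos)
    (hf ▸ one_pos) (by conv_lhs => rw [hye]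
                       module)
  exact ⟨w, x, y, e, e - x, hx, hy, he, rfl,
    (inFirstQuadrant_iff (by omega)).2 ⟨by omega, by omega⟩,
    (inSecondQuadrant_iff (by omega)).2 ⟨by omega, by omega⟩, hw⟩

/-- The starting basis is determined by `x` and `y`: the admissible `e` differ by multiples of `x`,
and `cross e y` lies in `(0, cross x y)`. -/
theorem start_unique {x y e e' : ℤ × ℤ} (hxy : 0 < cross x y) (he : cross x e = 1)
    (he' : cross x e' = 1) (h1 : 0 < cross e y) (h2 : cross (e - x) y < 0)
    (h1' : 0 < cross e' y) (h2' : cross (e' - x) y < 0) : e = e' := by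
  have hk := eq_cross_combination he e'
  rw [he', one_smul] at hk
  generalize cross e' e = k at *
  have h3 : cross e' y = k * cross x y + cross e y := by
    rw [hk]; unfold cross; simp; ring
  have h4 (v : ℤ × ℤ) : cross (v - x) y = cross v y - cross x y := by
    unfold cross; simp; ring
  rw [h4] at h2 h2'
  have hk0 : k = 0 := by
    rcases lt_trichotomy k 0 with h | h | h
    · nlinarith
    · exact h
    · nlinarith
  rw [hk, hk0, zero_smul, zero_add]

theorem cross_pos_of_quadrants {x y e : ℤ × ℤ} (he : cross x e = 1) (h : InFirstQuadrant x y e) :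
    0 < cross x y := by
  obtain ⟨α, β, hα, hβ, h1, h2⟩ := h
  have e1 : (cross x e : ℝ) = β * cross x y := by
    unfold cross; push_cast; rw [h1, h2]; ring
  rw [he, Int.cast_one] at e1
  have : (0 : ℝ) < cross x y := pos_of_mul_pos_right (e1 ▸ one_pos) hβ.le
  exact_mod_cast this

theorem transitionWord_unique {p q : ProjLine} {w w' : List Bool} (h : IsTransitionWord p q w)
    (h' : IsTransitionWord p q w') : w = w' := by
  obtain ⟨x, y, e, f, hx, hy, he, rfl, hq1, hq2, hw⟩ := h
  obtain ⟨x', y', e', f, hx', hy', he', rfl, hq1', hq2', hw'⟩ := h'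
  have hpos : 0 < cross x y := cross_pos_of_quadrants he hq1
  have hpos' : 0 < cross x' y' := cross_pos_of_quadrants he' hq1'
  have key {e' : ℤ × ℤ} (he' : cross x e' = 1) (hq1' : InFirstQuadrant x y e')
      (hq2' : InSecondQuadrant x y (e' - x)) (hw' : TransitionRun x y e' (e' - x) w') :
      w = w' := by
    rw [inFirstQuadrant_iff hpos] at hq1 hq1'
    rw [inSecondQuadrant_iff hpos] at hq2 hq2'
    obtain rfl := start_unique hpos he he' hq1.2 hq2.2 hq1'.2 hq2'.2
    exact hw.unique hpos hw'
  rcases hx.eq_or_eq_neg hx' with rfl | rfl <;> rcases hy.eq_or_eq_neg hy' with rfl | rfl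
  · exact key he' hq1' hq2' hw'
  · simp only [cross, Prod.fst_neg, Prod.snd_neg] at hpos hpos'; linarith
  · simp only [cross, Prod.fst_neg, Prod.snd_neg] at hpos hpos'; linarith
  · have h1 := hq1'.neg
    have h2 := hq2'.neg
    have h3 := hw'.neg
    simp only [neg_neg, neg_sub] at h1 h2 h3
    rw [show -x - e' = -e' - x by abel] at h2 h3
    refine key (e' := -e') ?_ h1 h2 h3
    simp only [cross, Prod.fst_neg, Prod.snd_neg] at he' ⊢; linarith

/-! ### Distances along the algorithm -/

/-- The distance produced by the word `w` of steps, started at a basis whose members are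
at the distances `d` and `d'`. -/
def wordDist : List Bool → ℕ → ℕ → ℕ
  | [], d, d' => min d d' + 1
  | true :: w, d, d' => wordDist w (min d d' + 1) d'
  | false :: w, d, d' => wordDist w d (min d d' + 1)

theorem TransitionRun.edist_eq {x y e f : ℤ × ℤ} {w : List Bool} (h : TransitionRun x y e f w)
    {p q pe pf : ProjLine} {d d' : ℕ} (hef : cross e f = 1) (hxe : 0 < cross x e)
    (hxf : 0 < cross x f) (hx : IsRep x p) (hy : IsRep y q) (he : IsRep e pe) (hf : IsRep f pf)
    (hd : distantGraph.edist pe p = d) (hd' : distantGraph.edist pf p = d') :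
    distantGraph.edist q p = wordDist w d d' := by
  induction h generalizing pe pf d d' with
  | done h =>
    subst h
    exact edist_mediant_natCast hef he hf hx hxe hxf hy hd hd'
  | first _ _ _ ih =>
    obtain ⟨pg, hg⟩ := exists_point (isCoprime_of_cross (cross_add_left hef))
    exact ih (cross_add_left hef) (cross_add_pos hxe hxf) hxf hg hf
      (edist_mediant_natCast hef he hf hx hxe hxf hg hd hd') hd'
  | second _ _ _ ih =>
    obtain ⟨pg, hg⟩ := exists_point (isCoprime_of_cross (cross_add_left hef))
    exact ih (cross_add_right hef) hxe (cross_add_pos hxe hxf) he hg hd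
      (edist_mediant_natCast hef he hf hx hxe hxf hg hd hd')

theorem edist_eq_wordDist {p q : ProjLine} {w : List Bool} (h : IsTransitionWord p q w) :
    distantGraph.edist p q = wordDist w 1 1 := by
  obtain ⟨x, y, e, f, hx, hy, he, rfl, hq1, hq2, hw⟩ := h
  have he : cross x e = 1 := he
  have hf : cross x (e - x) = 1 := by
    simp only [cross, Prod.fst_sub, Prod.snd_sub] at *; linarith
  have hef : cross e (e - x) = 1 := by
    simp only [cross, Prod.fst_sub, Prod.snd_sub] at *; linarith
  obtain ⟨pe, hpe⟩ := exists_point (isCoprime_of_cross hef)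
  obtain ⟨pf, hpf⟩ : ∃ pf, IsRep (e - x) pf := by
    refine exists_point (isCoprime_of_cross (v := -e) ?_)
    simp only [cross, Prod.fst_sub, Prod.snd_sub, Prod.fst_neg, Prod.snd_neg] at *; linarith
  rw [SimpleGraph.edist_comm]
  refine hw.edist_eq hef (he ▸ one_pos) (hf ▸ one_pos) hx hy hpe hpf ?_ ?_
  · rw [SimpleGraph.edist_comm, Nat.cast_one, SimpleGraph.edist_eq_one_iff_adj, adj_iff hx hpe]
    exact Or.inl he
  · rw [SimpleGraph.edist_comm, Nat.cast_one, SimpleGraph.edist_eq_one_iff_adj, adj_iff hx hpf]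
    exact Or.inl hf

/-! ### The diameter -/

/-- Alternating steps raise both distances by one every two steps, so that there are bases
arbitrarily far from a given point. -/
theorem exists_far_basis (n : ℕ) : ∃ (x e f : ℤ × ℤ) (p pe pf : ProjLine), cross e f = 1 ∧
    0 < cross x e ∧ 0 < cross x f ∧ IsRep x p ∧ IsRep e pe ∧ IsRep f pf ∧
    distantGraph.edist pe p = (n + 1 : ℕ) ∧ distantGraph.edist pf p = (n + 1 : ℕ) := by
  induction n with
  | zero =>
    obtain ⟨p, hp⟩ := exists_point (u := (1, -1)) isCoprime_one_left
    obtain ⟨pe, he⟩ := exists_point (u := (1, 0)) isCoprime_one_left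
    obtain ⟨pf, hf⟩ := exists_point (u := (0, 1)) isCoprime_one_right
    refine ⟨_, _, _, p, pe, pf, ?_, ?_, ?_, hp, he, hf, ?_, ?_⟩
    · simp [cross]
    · simp [cross]
    · simp [cross]
    · rw [zero_add, Nat.cast_one, SimpleGraph.edist_eq_one_iff_adj, adj_iff he hp]
      simp [cross]
    · rw [zero_add, Nat.cast_one, SimpleGraph.edist_eq_one_iff_adj, adj_iff hf hp]
      simp [cross]
  | succ n ih =>
    obtain ⟨x, e, f, p, pe, pf, hef, hxe, hxf, hx, he, hf, hd, hd'⟩ := ih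
    have hgf := cross_add_left hef
    have hgh := cross_add_right hgf
    have hxg := cross_add_pos hxe hxf
    obtain ⟨pg, hg⟩ := exists_point (isCoprime_of_cross hgf)
    obtain ⟨ph, hh⟩ := exists_point (isCoprime_of_cross (cross_add_left hgf))
    have hdg := edist_mediant_natCast hef he hf hx hxe hxf hg hd hd'
    have hdh := edist_mediant_natCast hgf hg hf hx hxg hxf hh hdg hd'
    refine ⟨x, _, _, p, pg, ph, hgh, hxg, cross_add_pos hxg hxf, hx, hg, hh, ?_, ?_⟩
    · rw [hdg, min_self]
    · rw [hdh, min_eq_right (by omega)]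

theorem ediam_distantGraph : distantGraph.ediam = ⊤ := by
  rw [ENat.eq_top_iff_forall_ge]
  intro n
  obtain ⟨x, e, f, p, pe, pf, -, -, -, -, -, -, hd, -⟩ := exists_far_basis n
  exact le_trans (by rw [hd]; exact_mod_cast n.le_succ) (SimpleGraph.edist_le_ediam (u := pe) (v := p))

/-! ### Counting along the runs of a word -/

/-- The word whose runs have the lengths `cs`, starting with the letter `b`. -/
def altWord : Bool → List ℕ → List Bool
  | _, [] => []
  | b, c :: cs => List.replicate c b ++ altWord (!b) cs

/-- A list of nonempty constant words, in which neighbours meet at different letters, alternates. -/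
theorem flatten_eq_altWord {Ls : List (List Bool)} (hc : ∀ m ∈ Ls, m.IsChain fun x y ↦ x == y)
    (hc' : Ls.IsChain fun a b ↦ ∃ ha hb, (a.getLast ha == b.head hb) = false) {b : Bool}
    (hb : ∀ m ∈ Ls.head?, ∃ h, m.head h = b) :
    Ls.flatten = altWord b (Ls.map List.length) ∧ ∀ c ∈ Ls.map List.length, 0 < c := by
  induction Ls generalizing b with
  | nil => simp [altWord]
  | cons m Ls ih =>
    obtain ⟨hm0, hmb⟩ := hb m (by simp)
    have hm : m = List.replicate m.length b := by
      have h1 := hc m (by simp)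
      simp only [beq_iff_eq] at h1
      exact List.isChain_eq_iff_eq_replicate.1 h1 b (by rw [List.head?_eq_some_head hm0, hmb]; rfl)
    have hlast : m.getLast hm0 = b := by
      exact (List.eq_replicate_iff.1 hm).2 _ (List.getLast_mem hm0)
    obtain ⟨h1, h2⟩ := ih (b := !b) (fun m' h' => hc m' (by simp [h'])) hc'.tail (by
      intro m' h'
      cases Ls with
      | nil => simp at h'
      | cons m'' Ls =>
        simp only [List.head?_cons, Option.mem_some_iff] at h'
        subst h'
        obtain ⟨ha, hb', hne⟩ := (List.isChain_cons_cons.1 hc').1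
        refine ⟨hb', ?_⟩
        rw [hlast] at hne
        revert hne
        cases b <;> cases m''.head hb' <;> simp)
    constructor
    · rw [List.flatten_cons, List.map_cons, altWord, ← h1, ← hm]
    · simp only [List.map_cons, List.mem_cons, forall_eq_or_imp]
      exact ⟨List.length_pos_iff.2 hm0, h2⟩

theorem exists_eq_altWord_runLengths (w : List Bool) :
    ∃ b, w = altWord b (runLengths w) ∧ ∀ c ∈ runLengths w, 0 < c := by
  have h1 : ∀ m ∈ w.splitBy (· == ·), m.IsChain fun x y ↦ x == y := fun m hm =>
    List.isChain_of_mem_splitBy hm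
  have h2 := List.isChain_getLast_head_splitBy (· == ·) w
  have h3 := List.nil_notMem_splitBy (· == ·) w
  have key (b : Bool) (hb : ∀ m ∈ (w.splitBy (· == ·)).head?, ∃ h, m.head h = b) :
      ∃ b, w = altWord b (runLengths w) ∧ ∀ c ∈ runLengths w, 0 < c := by
    obtain ⟨h4, h5⟩ := flatten_eq_altWord h1 h2 hb
    rw [List.flatten_splitBy] at h4
    exact ⟨b, h4, h5⟩
  cases hL : w.splitBy (· == ·) with
  | nil => exact key true (by simp [hL])
  | cons m Ls =>
    have hm : m ≠ [] := by
      rintro rfl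
      exact h3 (by simp [hL])
    exact key (m.head hm) (by simp [hL, hm])

/-- A pair of distances of `e` and `f` with minimum `m`: balanced if `q = true`, and otherwise farther
by one on the side changed by the letter `b` (`e` for `true`, `f` for `false`). -/
def distPair (b q : Bool) (m : ℕ) : ℕ × ℕ :=
  if q then (m, m) else if b then (m + 1, m) else (m, m + 1)

theorem wordDist_replicate_same (b : Bool) (c m : ℕ) (w : List Bool) :
    wordDist (List.replicate c b ++ w) (distPair b false m).1 (distPair b false m).2 =
      wordDist w (distPair b false m).1 (distPair b false m).2 := by
  induction c with
  | zero => rfl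
  | succ c ih =>
    rw [← ih]
    cases b <;> simp [List.replicate_succ, wordDist, distPair]

/-- The effect of a run of `!b` after a run of `b`: its first step raises the minimum unless the pair
was balanced, and the pair is balanced afterwards iff that step closed a gap and was the only one. -/
theorem wordDist_replicate (b q : Bool) (c m : ℕ) (hc : 0 < c) (w : List Bool) :
    wordDist (List.replicate c (!b) ++ w) (distPair b q m).1 (distPair b q m).2 =
      wordDist w (distPair (!b) (c == 1 && !q) (m + if q then 0 else 1)).1
        (distPair (!b) (c == 1 && !q) (m + if q then 0 else 1)).2 := by
  obtain ⟨c, rfl⟩ := Nat.exists_eq_succ_of_ne_zero hc.ne'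
  cases q
  · rcases c with _ | c
    · cases b <;> simp [wordDist, distPair]
    · have h := wordDist_replicate_same (!b) c (m + 1) w
      cases b <;> simpa [List.replicate_succ, wordDist, distPair] using h
  · have h := wordDist_replicate_same (!b) c m w
    cases b <;> simpa [List.replicate_succ, wordDist, distPair] using h

/-- Whether the distances of the two members of the basis are balanced after `i` runs of lengths
`c 0, c 1, …`, given whether they are so at the start. -/
def balanced (c : ℕ → ℕ) (q : Bool) : ℕ → Bool
  | 0 => q
  | i + 1 => c i == 1 && !balanced c q i

theorem balanced_shift (c : ℕ → ℕ) (q : Bool) (i : ℕ) :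
    balanced c q (i + 1) = balanced (fun j => c (j + 1)) (c 0 == 1 && !q) i := by
  induction i with
  | zero => rfl
  | succ i ih => rw [balanced, ih]; rfl

theorem wordDist_altWord (cs : List ℕ) (hcs : ∀ c ∈ cs, 0 < c) (b q : Bool) (m : ℕ) :
    wordDist (altWord (!b) cs) (distPair b q m).1 (distPair b q m).2 =
      m + 1 + ∑ i ∈ Finset.range cs.length,
        if balanced (fun i => cs.getD i 1) q i then 0 else 1 := by
  induction cs generalizing b q m with
  | nil => cases b <;> cases q <;> simp [altWord, wordDist, distPair]
  | cons c cs ih =>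
    simp only [List.mem_cons, forall_eq_or_imp] at hcs
    rw [altWord, wordDist_replicate _ _ _ _ hcs.1, ih hcs.2, List.length_cons,
      Finset.sum_range_succ']
    simp only [balanced_shift, List.getD_cons_succ, List.getD_cons_zero]
    change m + (if q then 0 else 1) + 1 + _ = m + 1 + (_ + if q then 0 else 1)
    ring

theorem wordDist_one_one (w : List Bool) :
    wordDist w 1 1 = 2 + ∑ i ∈ Finset.range (runLengths w).length,
      if balanced (fun i => (runLengths w).getD i 1) true i then 0 else 1 := by
  obtain ⟨b, hb, hpos⟩ := exists_eq_altWord_runLengths w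
  have h := wordDist_altWord (runLengths w) hpos (!b) true 1
  rw [Bool.not_not, ← hb] at h
  simpa [distPair] using h

/-! ### The closed formula -/

theorem onesBefore_succ (u : ℕ → ℕ) (k : ℕ) :
    onesBefore u (k + 1) = if u k = 1 then onesBefore u k + 1 else 0 := by
  unfold onesBefore
  have hshift (j : ℕ) : (∀ i < j + 1, u (k + 1 - 1 - i) = 1) ↔
      u k = 1 ∧ ∀ i < j, u (k - 1 - i) = 1 := by
    constructor
    · intro h
      refine ⟨by simpa using h 0 (by omega), fun i hi => ?_⟩
      have := h (i + 1) (by omega)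
      rwa [show k + 1 - 1 - (i + 1) = k - 1 - i by omega] at this
    · rintro ⟨h0, h⟩ i hi
      rcases i with _ | i
      · simpa using h0
      · have := h i (by omega)
        rwa [show k + 1 - 1 - (i + 1) = k - 1 - i by omega]
  split_ifs with hk
  · rw [Nat.findGreatest_eq_iff]
    have hspec := Nat.findGreatest_spec (P := fun j => ∀ i < j, u (k - 1 - i) = 1) (m := 0) (n := k)
      (Nat.zero_le _) (by simp)
    refine ⟨by have := Nat.findGreatest_le (P := fun j => ∀ i < j, u (k - 1 - i) = 1) k; omega,
      fun _ => (hshift _).2 ⟨hk, hspec⟩, ?_⟩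
    intro n hn hnk h
    obtain ⟨n, rfl⟩ : ∃ n', n = n' + 1 := ⟨n - 1, by omega⟩
    exact Nat.findGreatest_is_greatest (P := fun j => ∀ i < j, u (k - 1 - i) = 1) (k := n) (n := k)
      (by omega) (by omega) ((hshift n).1 h).2
  · rw [Nat.findGreatest_eq_zero_iff]
    intro n hn _ h
    exact hk (by simpa using h 0 hn)

theorem floor_one_div (a : ℕ) : ⌊1 / (a : ℚ)⌋ = if a = 1 then 1 else 0 := by
  rcases a with _ | _ | a
  · simp
  · simp
  · rw [if_neg (by omega), Int.floor_eq_zero_iff]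
    constructor
    · positivity
    · rw [div_lt_one (by positivity)]
      push_cast
      have : (0 : ℚ) ≤ a := by positivity
      linarith

theorem shortening_eq (w : List Bool) (k : ℕ) :
    shortening w k = if tildeA w k = 1 ∨ tildeB w k = 1 then 1 else 0 := by
  unfold shortening
  rw [floor_one_div, floor_one_div]
  by_cases h1 : tildeA w k = 1 <;> by_cases h2 : tildeB w k = 1 <;>
    simp only [h1, h2, if_true, if_false, or_true, true_or, or_self] <;>
    rw [Int.floor_eq_iff] <;> norm_num

/-- The summand of the formula at `k` with the condition `k ∈ D` built in, for the sequences `A`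
and `B` in place of `ã` and `b̃`. -/
def pairTerm (A B : ℕ → ℕ) (k : ℕ) : ℕ :=
  if B k = 1 ∨ (A k = 1 ∧ onesBefore B k ≤ onesBefore A k) then 1 else 0

theorem sum_shortening {w : List Bool} (hB : ∀ k, tildeB w k ≠ 0) :
    ∑ k ∈ indexD w, shortening w k =
      ∑ k ∈ Finset.Icc 1 (numL w), (pairTerm (tildeA w) (tildeB w) k : ℤ) := by
  rw [indexD, Finset.sum_filter]
  refine Finset.sum_congr rfl fun k _ => ?_
  rw [shortening_eq, pairTerm]
  have := hB k
  by_cases h1 : tildeA w k = 1 <;> by_cases h2 : tildeB w k = 1 <;>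
    by_cases h3 : onesBefore (tildeB w) k ≤ onesBefore (tildeA w) k <;>
    simp [h1, h2, h3]
  all_goals omega

/-- The balance after `2 * K` runs and the comparison of the blocks of ones ending at the `K`-th
pair satisfy the same recursion in `K`. The condition `A 1 ≠ 1` reflects that the first run never
ends balanced, whatever its length, since the starting pair is balanced. -/
theorem balanced_two_mul_iff {c A B : ℕ → ℕ} {K : ℕ} (hA1 : A 1 ≠ 1)
    (hA : ∀ k, 1 ≤ k → k < K → A (k + 1) = c (2 * k)) (hB : ∀ k < K, B (k + 1) = c (2 * k + 1))
    (hK : 0 < K) :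
    balanced c true (2 * K) = true ↔ onesBefore A (K + 1) < onesBefore B (K + 1) := by
  induction K with
  | zero => omega
  | succ K ih =>
    rw [onesBefore_succ A, onesBefore_succ B, hB K (by omega),
      show 2 * (K + 1) = 2 * K + 1 + 1 by ring, balanced, balanced]
    rcases Nat.eq_zero_or_pos K with rfl | hK
    · by_cases h : c 1 = 1 <;> simp [hA1, balanced, h]
    · have ih := ih (fun k h1 h2 => hA k h1 (by omega)) (fun k h => hB k (by omega)) hK
      rw [hA K hK (by omega)]
      by_cases h1 : c (2 * K) = 1 <;> by_cases h2 : c (2 * K + 1) = 1 <;> simp [h1, h2, ih]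

theorem balanced_odd_iff {c A B : ℕ → ℕ} {K : ℕ} (hA1 : A 1 ≠ 1)
    (hA : ∀ k, 1 ≤ k → k ≤ K → A (k + 1) = c (2 * k)) (hB : ∀ k < K, B (k + 1) = c (2 * k + 1)) :
    balanced c true (2 * K + 1) = true ↔
      A (K + 1) = 1 ∧ onesBefore B (K + 1) ≤ onesBefore A (K + 1) := by
  rcases Nat.eq_zero_or_pos K with rfl | hK
  · simp [hA1, balanced]
  · rw [balanced, hA K hK le_rfl, Bool.and_eq_true, beq_iff_eq, Bool.not_eq_true',
      ← Bool.not_eq_true, balanced_two_mul_iff hA1 (fun k h1 h2 => hA k h1 (by omega)) hB hK,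
      not_lt]

/-- Each pair of runs raises the distance by two, less its summand in the formula. -/
theorem sum_balanced {c A B : ℕ → ℕ} {K : ℕ} (hA1 : A 1 ≠ 1)
    (hA : ∀ k, 1 ≤ k → k < K → A (k + 1) = c (2 * k)) (hB : ∀ k < K, B (k + 1) = c (2 * k + 1)) :
    ∑ i ∈ Finset.range (2 * K + 1), (if balanced c true i then 0 else 1) +
      ∑ k ∈ Finset.Icc 1 K, pairTerm A B k = 2 * K := by
  induction K with
  | zero => simp [balanced]
  | succ K ih =>
    have ih := ih (fun k h1 h2 => hA k h1 (by omega)) (fun k h => hB k (by omega))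
    have h1 := balanced_odd_iff (K := K) hA1 (fun k h1 h2 => hA k h1 (by omega))
      (fun k h => hB k (by omega))
    rw [show 2 * (K + 1) + 1 = 2 * K + 2 + 1 by ring, Finset.sum_range_succ,
      Finset.sum_range_succ, Finset.sum_Icc_succ_top (by omega)]
    have h2 : balanced c true (2 * K + 2) =
        (c (2 * K + 1) == 1 && !balanced c true (2 * K + 1)) := rfl
    have h3 : (if balanced c true (2 * K + 1) then 0 else 1) +
        (if balanced c true (2 * K + 2) then 0 else 1) + pairTerm A B (K + 1) = 2 := by
      simp only [h2, pairTerm, ← h1, hB K (by omega)]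
      by_cases h4 : c (2 * K + 1) = 1 <;> cases balanced c true (2 * K + 1) <;> simp [h4]
    omega

/-- If the number of runs is even, the balance after the last run does not count, as no run follows;
`B (K + 1) ≠ 1` accounts for this. -/
theorem sum_balanced_even {c A B : ℕ → ℕ} {K : ℕ} (hA1 : A 1 ≠ 1)
    (hA : ∀ k, 1 ≤ k → k ≤ K → A (k + 1) = c (2 * k)) (hB : ∀ k < K, B (k + 1) = c (2 * k + 1))
    (hBl : B (K + 1) ≠ 1) :
    ∑ i ∈ Finset.range (2 * K + 2), (if balanced c true i then 0 else 1) +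
      ∑ k ∈ Finset.Icc 1 (K + 1), pairTerm A B k = 2 * K + 1 := by
  have h0 := sum_balanced (K := K) hA1 (fun k h1 h2 => hA k h1 (by omega)) hB
  have h1 := balanced_odd_iff (K := K) hA1 hA hB
  rw [Finset.sum_range_succ, Finset.sum_Icc_succ_top (by omega)]
  have h3 : (if balanced c true (2 * K + 1) then 0 else 1) + pairTerm A B (K + 1) = 1 := by
    simp only [pairTerm, ← h1]
    cases balanced c true (2 * K + 1) <;> simp [hBl]
  omega

theorem tildeB_ne_zero {w : List Bool} (k : ℕ) : tildeB w k ≠ 0 := by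
  have h : seqB w k ≠ 0 := by
    rcases k with _ | k
    · simp [seqB]
    · obtain ⟨b, -, hpos⟩ := exists_eq_altWord_runLengths w
      rw [seqB, List.getD_eq_getElem?_getD]
      rcases lt_or_ge (2 * k + 1) (runLengths w).length with h | h
      · rw [List.getElem?_eq_getElem h]
        exact (hpos _ (List.getElem_mem h)).ne'
      · simp [List.getElem?_eq_none h]
  unfold tildeB
  split_ifs <;> omega

theorem wordDist_formula (w : List Bool) :
    (wordDist w 1 1 : ℤ) = if 0 < numL w then
      (numR w : ℤ) + (numL w : ℤ) + 1 - ∑ k ∈ indexD w, shortening w k else 2 := by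
  rw [wordDist_one_one]
  set c := fun i => (runLengths w).getD i 1 with hc
  set n := (runLengths w).length with hn
  have hr : numR w = (n + 1) / 2 := rfl
  have hl : numL w = n / 2 := rfl
  split_ifs with hpos
  · rw [sum_shortening tildeB_ne_zero]
    have hA1 : tildeA w 1 ≠ 1 := by simp [tildeA]; omega
    have hA (k : ℕ) (hk : 1 ≤ k) : tildeA w (k + 1) = c (2 * k) := by
      rw [tildeA, if_neg (by omega)]; rfl
    have hB (k : ℕ) (hk : numR w = numL w → k + 1 < numL w) :
        tildeB w (k + 1) = c (2 * k + 1) := by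
      rw [tildeB, if_neg (by rintro ⟨h1, h2⟩; have := hk h1; omega)]; rfl
    rcases Nat.even_or_odd' n with ⟨l, h | h⟩
    · obtain ⟨K, rfl⟩ : ∃ K, l = K + 1 := ⟨l - 1, by omega⟩
      have hlK : numL w = K + 1 := by omega
      have hrK : numR w = K + 1 := by omega
      have := sum_balanced_even (c := c) (K := K) hA1 (fun k h1 _ => hA k h1)
        (fun k h => hB k (by omega)) (B := tildeB w) (by
          rw [tildeB, if_pos ⟨by omega, by omega⟩]; omega)
      rw [h, hlK, hrK, show 2 * (K + 1) = 2 * K + 2 by ring]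
      push_cast [← @Nat.cast_inj ℤ] at this ⊢
      linarith
    · have hlK : numL w = l := by omega
      have hrK : numR w = l + 1 := by omega
      have := sum_balanced (c := c) (K := l) hA1 (fun k h1 _ => hA k h1)
        (fun k h => hB k (by omega)) (B := tildeB w)
      rw [h, hlK, hrK]
      push_cast [← @Nat.cast_inj ℤ] at this ⊢
      linarith
  · have : n = 0 ∨ n = 1 := by omega
    rcases this with h | h <;> simp [h, balanced]

theorem theorem2 :
    (∀ p q : ProjLine, p ≠ q → ¬ distantGraph.Adj p q →
      (∃! w : List Bool, IsTransitionWord p q w) ∧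
      ∀ w : List Bool, IsTransitionWord p q w →
        distantGraph.Reachable p q ∧
        (distantGraph.dist p q : ℤ) =
          if 0 < numL w then
            (numR w : ℤ) + (numL w : ℤ) + 1 - ∑ k ∈ indexD w, shortening w k
          else 2) ∧
    distantGraph.ediam = ⊤ := by
  refine ⟨fun p q hpq hadj => ⟨?_, fun w hw => ?_⟩, ediam_distantGraph⟩
  · obtain ⟨w, hw⟩ := exists_transitionWord hpq hadj
    exact ⟨w, hw, fun w' hw' => transitionWord_unique hw' hw⟩
  · have h := edist_eq_wordDist hw
    refine ⟨SimpleGraph.reachable_of_edist_ne_top (by rw [h]; exact ENat.natCast_ne_top _), ?_⟩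
    rw [← wordDist_formula, SimpleGraph.dist, h, ENat.toNat_natCast]
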